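/- Let $R$ be a commutative ring with $1 \neq 0$ and let $M$ be a faithful $R$-module, i.e. $\mathrm{ann}_R(M)=0$. Let $G_M(R)$ be the graph whose vertices are the non-trivial (that is, non-zero proper) ideals of $R$, in which two distinct vertices $I$ and $J$ are adjacent if and only if $IM\cap JM\neq 0$. Suppose that $G_M(R)$ is a null graph, i.e. it has no edges. Then $G_M(R)$ has at most two vertices. If moreover $R$ is not a field (equivalently, if $G_M(R)$ has at least one vertex), then $R$ is isomorphic to one of the following rings: 1. $F_1\times F_2$, where $F_1$ and $F_2$ are fields; 2. $F[x]/(x^2)$, where $F$ is a field; 3. $L$, where $L$ is a coefficient ring of characteristic $p^2$ for some prime number $p$. Here a coefficient ring is a local ring $(L,\mathfrak m)$ that is complete (and separated) in the $\mathfrak m$-adic topology and whose maximal ideal $\mathfrak m$ is generated by the characteristic of its residue field $L/\mathfrak m$. -/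

import Mathlib

universe u v

/-- The non-trivial ideals of a ring: the non-zero proper ones. -/
abbrev NontrivialIdeal (R : Type u) [CommRing R] : Type u :=
  {I : Ideal R // I ≠ ⊥ ∧ I ≠ ⊤}

/-- The `M`-intersection graph of ideals of `R`: its vertices are the non-trivial ideals of `R`,
and distinct vertices `I`, `J` are adjacent if and only if `IM ∩ JM ≠ 0`. -/
def intersectionGraph (R : Type u) [CommRing R] (M : Type v) [AddCommGroup M] [Module R M] :
    SimpleGraph (NontrivialIdeal R) where
  Adj I J := I ≠ J ∧ (I.1 • (⊤ : Submodule R M)) ⊓ (J.1 • (⊤ : Submodule R M)) ≠ ⊥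
  symm := ⟨fun _ _ h => ⟨h.1.symm, by rw [inf_comm]; exact h.2⟩⟩
  loopless := ⟨fun _ h => h.1 rfl⟩

/-- A coefficient ring: a complete (and separated) local ring whose maximal ideal is generated
by the characteristic of its residue field. -/
structure IsCoefficientRing (L : Type u) [CommRing L] : Prop where
  isLocalRing : IsLocalRing L
  isAdicComplete : IsAdicComplete (IsLocalRing.maximalIdeal L) L
  maximalIdeal_eq : IsLocalRing.maximalIdeal L =
    Ideal.span {((ringChar (IsLocalRing.ResidueField L) : ℕ) : L)}

/-! Faithfulness gives `IM ≠ 0` for `I ≠ 0`, so nested distinct non-trivial ideals would be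
adjacent: every non-trivial ideal is both maximal and minimal. Two distinct ones meet in `0`, hence
any third, being prime, contains and so equals one of them, and the Chinese remainder theorem splits
`R` into two fields. If `𝔪` is the only one, `R` is local, `𝔪` is principal and Nakayama gives `𝔪² =
0`. When `R` has the characteristic of its residue field, it contains a coefficient field `F` (by
formal smoothness over `ℚ`, or by Zorn in characteristic `p`), so `R = F + Ft`. Otherwise `p ≠ 0`
generates `𝔪` and `p² = 0`. -/

open Polynomial in
/-- If `xᵖ` comes from the field `K` but is not a `p`-th power in `K`, then every polynomial in `x`
over `K` that lies in a proper ideal vanishes. -/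
theorem eval₂_eq_zero_of_mem_of_forall_pow_ne {K R : Type*} [Field K] [CommRing R] {p : ℕ}
    (hp : p.Prime) (f : K →+* R) {I : Ideal R} (hI : I ≠ ⊤) {x : R} {c : K} (hc : f c = x ^ p)
    (hb : ∀ b : K, b ^ p ≠ c) {g : K[X]} (hg : g.eval₂ f x ∈ I) : g.eval₂ f x = 0 := by
  have hirr := X_pow_sub_C_irreducible_of_prime hp hb
  have hroot : (X ^ p - C c : K[X]).eval₂ f x = 0 := by simp [hc]
  -- If `g` is coprime to `X ^ p - C c`, then `g(x)` is a unit, which a proper ideal cannot contain.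
  rcases hirr.isCoprime_or_dvd g with h | ⟨q, rfl⟩
  · obtain ⟨u, v, huv⟩ := h
    refine absurd ((Ideal.eq_top_iff_one I).2 ?_) hI
    have h1 := congrArg (eval₂ f x) huv
    rw [eval₂_add, eval₂_mul, eval₂_mul, hroot, mul_zero, zero_add, eval₂_one] at h1
    exact h1 ▸ I.mul_mem_left _ hg
  · rw [eval₂_mul, hroot, zero_mul]

open Polynomial IsLocalRing in
/-- A local ring of prime characteristic whose maximal ideal has square zero contains a subfield
mapping onto the residue field. -/
theorem exists_coefficientField_of_charP {R : Type u} [CommRing R] [IsLocalRing R] {p : ℕ}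
    (hp : p.Prime) [CharP R p] (hm : ∀ x ∈ maximalIdeal R, ∀ y ∈ maximalIdeal R, x * y = 0) :
    ∃ (F : Type u) (_ : Field F) (f : F →+* R), ∀ r, ∃ a, r - f a ∈ maximalIdeal R := by
  have : Fact p.Prime := ⟨hp⟩
  have hpow : ∀ x ∈ maximalIdeal R, x ^ p = 0 := fun x hx => by
    obtain ⟨k, rfl⟩ := Nat.exists_eq_add_of_le hp.two_le
    rw [pow_add, pow_two, hm x hx x hx, zero_mul]
  -- Containing all `p`-th powers makes such a subring a field: `a⁻¹ = a ^ (p - 1) * (a⁻¹) ^ p`.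
  let S : Set (Subring R) := {A | (∀ x, x ^ p ∈ A) ∧ ∀ x ∈ A, x ∈ maximalIdeal R → x = 0}
  have hbase : (frobenius R p).range ∈ S := by
    refine ⟨fun x => ⟨x, rfl⟩, ?_⟩
    rintro _ ⟨x, rfl⟩ hx
    rw [frobenius_def] at hx ⊢
    exact hpow x (Ideal.IsPrime.mem_of_pow_mem inferInstance p hx)
  obtain ⟨A, -, hA⟩ := zorn_le_nonempty₀ S (fun c hcS hc y hy => by
    refine ⟨sSup c, ⟨fun x => ?_, fun x hx hxm => ?_⟩, fun z hz => le_sSup hz⟩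
    · exact le_sSup hy ((hcS hy).1 x)
    · obtain ⟨s, hs, hxs⟩ := (Subring.mem_sSup_of_directedOn ⟨y, hy⟩ hc.directedOn).1 hx
      exact (hcS hs).2 x hxs hxm) _ hbase
  have hfield : IsField A := by
    refine ⟨⟨0, 1, zero_ne_one⟩, mul_comm, fun {a} ha => ?_⟩
    have hu : IsUnit (a : R) := by
      by_contra h
      exact ha (Subtype.ext (hA.prop.2 a a.2 h))
    obtain ⟨b, hb⟩ := hu.exists_right_inv
    refine ⟨⟨a ^ (p - 1) * b ^ p, A.mul_mem (A.pow_mem a.2 _) (hA.prop.1 b)⟩, Subtype.ext ?_⟩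
    change (a : R) * (a ^ (p - 1) * b ^ p) = 1
    rw [← mul_assoc, mul_pow_sub_one hp.ne_zero, ← mul_pow, hb, one_pow]
  let := hfield.toField
  refine ⟨A, inferInstance, A.subtype, fun x => ?_⟩
  by_contra! hx
  -- If `b ^ p = x ^ p` with `b ∈ A`, then `(x - b) ^ p = 0` puts `x - b` in `𝔪`, against `hx`. So
  -- `x ^ p` is not a `p`-th power in `A`, and `A[x]` contradicts maximality.
  let B : Subring R := (eval₂RingHom A.subtype x).range
  have hAB : A ≤ B := fun a ha => ⟨C ⟨a, ha⟩, by simp⟩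
  have hB : B ∈ S := by
    refine ⟨fun y => hAB (hA.prop.1 y), ?_⟩
    rintro _ ⟨g, rfl⟩ hg
    refine eval₂_eq_zero_of_mem_of_forall_pow_ne hp A.subtype
      (Ideal.IsMaximal.ne_top inferInstance) (c := ⟨x ^ p, hA.prop.1 x⟩) rfl (fun b hb => ?_) hg
    have h1 : (b : R) ^ p = x ^ p := congrArg Subtype.val hb
    refine hx b (Ideal.IsPrime.mem_of_pow_mem inferInstance p ?_)
    rw [sub_pow_char]
    simp [h1]
  have hxA : x ∈ A := hA.le_of_ge hB hAB ⟨X, by simp⟩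
  exact hx ⟨x, hxA⟩ (by simp)

open IsLocalRing in
/-- A local ring of equal characteristic zero whose maximal ideal is nilpotent contains a subfield
mapping onto the residue field. -/
theorem exists_coefficientField_of_charZero {R : Type u} [CommRing R] [IsLocalRing R]
    [CharZero (ResidueField R)] (hm : IsNilpotent (maximalIdeal R)) :
    ∃ (F : Type u) (_ : Field F) (f : F →+* R), ∀ r, ∃ a, r - f a ∈ maximalIdeal R := by
  obtain ⟨inst⟩ := EqualCharZero.nonempty_algebraRat_iff (R := R) |>.2 fun I hI =>
    RingHom.charZero (S := ResidueField R) (Ideal.Quotient.factor (le_maximalIdeal hI))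
  obtain ⟨s, hs⟩ := exists_isTranscendenceBasis ℚ (ResidueField R)
  have := hs.isAlgebraic_field
  -- The residue field is separable algebraic over a purely transcendental extension of `ℚ`;
  -- smoothness then lifts the identity through the nilpotent ideal `𝔪`.
  have : Algebra.FormallySmooth ℚ (ResidueField R) :=
    .of_algebraicIndependent_of_isSeparable hs.1
  let i : ResidueField R →ₐ[ℚ] R ⧸ maximalIdeal R :=
    RingHom.toRatAlgHom (RingHom.id (ResidueField R))
  let σ : ResidueField R →ₐ[ℚ] R := Algebra.FormallySmooth.lift (maximalIdeal R) hm i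
  refine ⟨ResidueField R, inferInstance, σ, fun r => ⟨residue R r, ?_⟩⟩
  rw [← Ideal.Quotient.eq]
  exact (Algebra.FormallySmooth.mk_lift (maximalIdeal R) hm i (residue R r)).symm

open Polynomial IsLocalRing in
/-- A local ring with principal non-zero maximal ideal of square zero and with a coefficient field
is a ring of dual numbers. -/
theorem nonempty_ringEquiv_quotient_X_sq {F R : Type*} [Field F] [CommRing R] [IsLocalRing R]
    (f : F →+* R) (hf : ∀ r, ∃ a, r - f a ∈ maximalIdeal R) {t : R} (ht : t ≠ 0) (ht2 : t * t = 0)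
    (hm : maximalIdeal R = Ideal.span {t}) :
    Nonempty (R ≃+* F[X] ⧸ Ideal.span {(X : F[X]) ^ 2}) := by
  have htm : t ∈ maximalIdeal R := hm ▸ Ideal.mem_span_singleton_self t
  have hf0 : ∀ a, f a ∈ maximalIdeal R → a = 0 := fun a ha => by
    by_contra h
    exact ha ((IsUnit.mk0 a h).map f)
  have hsurj : Function.Surjective (eval₂RingHom f t) := fun r => by
    obtain ⟨a, ha⟩ := hf r
    rw [hm, Ideal.mem_span_singleton'] at ha
    obtain ⟨s, hs⟩ := ha
    obtain ⟨b, hb⟩ := hf s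
    rw [hm, Ideal.mem_span_singleton'] at hb
    obtain ⟨u, hu⟩ := hb
    refine ⟨C a + C b * X, ?_⟩
    simp only [coe_eval₂RingHom, eval₂_add, eval₂_mul, eval₂_C, eval₂_X]
    linear_combination hs + t * hu - u * ht2
  have hker : RingHom.ker (eval₂RingHom f t) = Ideal.span {(X : F[X]) ^ 2} := by
    refine le_antisymm (fun g hg => ?_) ?_
    · rw [Ideal.mem_span_singleton, X_pow_dvd_iff]
      rw [RingHom.mem_ker, coe_eval₂RingHom] at hg
      -- Writing `g = g₀ + g₁X + X²q`, evaluation at `t` leaves `g₀ + g₁t = 0`. Thus `g₀ ∈ 𝔪`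
      -- vanishes, and a non-zero `g₁` would be a unit killing `t`.
      have hg' := congrArg (eval₂ f t) (divX_mul_X_add g)
      have hg'' := congrArg (eval₂ f t) (divX_mul_X_add g.divX)
      simp only [eval₂_add, eval₂_mul, eval₂_C, eval₂_X, coeff_divX, zero_add, hg] at hg' hg''
      have h0 : g.coeff 0 = 0 := by
        refine hf0 _ ?_
        rw [eq_neg_of_add_eq_zero_right hg']
        exact neg_mem (Ideal.mul_mem_left _ _ htm)
      have h1 : g.coeff 1 = 0 := by
        by_contra h
        have hu := (IsUnit.mk0 _ h).map f
        refine ht (hu.mul_right_eq_zero.1 ?_)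
        rw [h0, map_zero] at hg'
        linear_combination hg' + t * hg'' - eval₂ f t g.divX.divX * ht2
      intro d hd
      interval_cases d
      · exact h0
      · exact h1
    · rw [Ideal.span_le, Set.singleton_subset_iff, SetLike.mem_coe, RingHom.mem_ker]
      simp [pow_two, ht2]
  exact ⟨((Ideal.quotEquivOfEq hker.symm).trans
    (RingHom.quotientKerEquivOfSurjective hsurj)).symm⟩

/-- A ring is complete with respect to an ideal of square zero. -/
theorem isAdicComplete_of_sq_eq_bot {R : Type*} [CommRing R] {I : Ideal R} (hI : I ^ 2 = ⊥) :
    IsAdicComplete I R where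
  haus' x hx := by simpa [hI, SModEq.bot] using hx 2
  -- A Cauchy sequence is constant from index 2 on.
  prec' f hf := ⟨f 2, fun n => by
    rcases le_total n 2 with h | h
    · exact hf h
    · have := hf h
      rw [hI, Submodule.bot_smul, SModEq.bot] at this
      rw [this]⟩

open IsLocalRing in
/-- A local ring that is not a field and whose only non-trivial ideal is the maximal one is either a
ring of dual numbers over a field or a coefficient ring of characteristic `p ^ 2`. -/
theorem dualNumber_or_isCoefficientRing {R : Type u} [CommRing R] [IsLocalRing R]
    (h0 : maximalIdeal R ≠ ⊥) (h : ∀ I : Ideal R, I ≠ ⊥ → I ≠ ⊤ → I = maximalIdeal R) :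
    (∃ (F : Type u) (_ : Field F),
      Nonempty (R ≃+* Polynomial F ⧸ Ideal.span {(Polynomial.X : Polynomial F) ^ 2})) ∨
    ∃ p : ℕ, p.Prime ∧ IsCoefficientRing R ∧ CharP R (p ^ 2) := by
  have hspan : ∀ t ∈ maximalIdeal R, t ≠ 0 → maximalIdeal R = Ideal.span {t} := fun t ht ht0 => by
    refine (h _ (by simpa using ht0) fun h' => ?_).symm
    exact (mem_maximalIdeal t).1 ht (Ideal.span_singleton_eq_top.1 h')
  obtain ⟨t, htm, ht⟩ := Submodule.exists_mem_ne_zero_of_ne_bot h0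
  have hsq : maximalIdeal R ^ 2 = ⊥ := by
    -- A non-zero `𝔪²` would equal `𝔪`, contradicting Nakayama.
    by_contra hne
    have hm := h _ hne fun h' =>
      (Ideal.IsMaximal.ne_top (I := maximalIdeal R) inferInstance)
        (top_le_iff.1 (h' ▸ Ideal.pow_le_self two_ne_zero))
    refine h0 (Submodule.eq_bot_of_le_smul_of_le_jacobson_bot (maximalIdeal R) _
      ⟨{t}, by simpa using (hspan t htm ht).symm⟩ ?_ (maximalIdeal_le_jacobson _))
    rw [smul_eq_mul, ← pow_two, hm]
  have hmul : ∀ x ∈ maximalIdeal R, ∀ y ∈ maximalIdeal R, x * y = 0 := fun x hx y hy => by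
    rw [← Ideal.mem_bot, ← hsq, pow_two]
    exact Ideal.mul_mem_mul hx hy
  have hdual : (∃ (F : Type u) (_ : Field F) (f : F →+* R), ∀ r, ∃ a, r - f a ∈ maximalIdeal R) →
      ∃ (F : Type u) (_ : Field F),
        Nonempty (R ≃+* Polynomial F ⧸ Ideal.span {(Polynomial.X : Polynomial F) ^ 2}) := by
    rintro ⟨F, inst, f, hf⟩
    exact ⟨F, inst, nonempty_ringEquiv_quotient_X_sq f hf ht (hmul t htm t htm) (hspan t htm ht)⟩
  rcases CharP.exists' (ResidueField R) with hchar | ⟨p, ⟨hp⟩, hchar⟩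
  · exact .inl (hdual (exists_coefficientField_of_charZero ⟨2, hsq⟩))
  have hpm : (p : R) ∈ maximalIdeal R := by
    rw [← residue_eq_zero_iff, map_natCast, CharP.cast_eq_zero]
  by_cases hpR : (p : R) = 0
  · have : CharP R p := (CharP.charP_iff_prime_eq_zero hp).2 hpR
    exact .inl (hdual (exists_coefficientField_of_charP hp hmul))
  · refine .inr ⟨p, hp, ⟨inferInstance, isAdicComplete_of_sq_eq_bot hsq, ?_⟩, ?_⟩
    · rw [ringChar.eq (ResidueField R) p]
      exact hspan _ hpm hpR
    · have hdvd : ringChar R ∣ p ^ 2 := ringChar.dvd (by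
        rw [Nat.cast_pow, pow_two, hmul _ hpm _ hpm])
      obtain ⟨k, hk, hkR⟩ := (Nat.dvd_prime_pow hp).1 hdvd
      have hk2 : k = 2 := by
        by_contra hne
        have hp' : ringChar R ∣ p := by
          rw [hkR]
          exact (pow_dvd_pow p (by omega : k ≤ 1)).trans (pow_one p).dvd
        exact hpR ((ringChar.spec R p).2 hp')
      rw [← hk2, ← hkR]
      exact ringChar.charP R

/-- If the intersection graph of a faithful module has no edges, then two distinct non-trivial
ideals never contain one another. -/
theorem eq_of_le_of_edgeSet_eq_empty {R : Type u} [CommRing R] {M : Type v} [AddCommGroup M]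
    [Module R M] (hM : Module.annihilator R M = ⊥) (hG : (intersectionGraph R M).edgeSet = ∅)
    {I J : Ideal R} (hI : I ≠ ⊥) (hJ : J ≠ ⊤) (hIJ : I ≤ J) : I = J := by
  have hbot : (intersectionGraph R M) = ⊥ := SimpleGraph.edgeSet_eq_empty.1 hG
  by_contra hne
  have hI' : I ≠ ⊤ := fun h => hJ (top_le_iff.1 (h ▸ hIJ))
  have hJ' : J ≠ ⊥ := fun h => hI (le_bot_iff.1 (h ▸ hIJ))
  have hadj : ¬ (intersectionGraph R M).Adj ⟨I, hI, hI'⟩ ⟨J, hJ', hJ⟩ := by simp [hbot]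
  have hzero : I • (⊤ : Submodule R M) = ⊥ := by
    by_contra h
    refine hadj ⟨fun h' => hne (congrArg Subtype.val h'), ?_⟩
    -- Since `I ≤ J`, the intersection of `IM` and `JM` is `IM` itself.
    rwa [inf_eq_left.2 (Submodule.smul_mono_left hIJ)]
  refine hI (le_bot_iff.1 (hM ▸ fun r hr => Module.mem_annihilator.2 fun x => ?_))
  rw [← Submodule.mem_bot R, ← hzero]
  exact Submodule.smul_mem_smul hr trivial

theorem mainTheorem9 (R : Type u) [CommRing R] [Nontrivial R]
    (M : Type v) [AddCommGroup M] [Module R M]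
    (hM : Module.annihilator R M = ⊥)
    (hG : (intersectionGraph R M).edgeSet = ∅) :
    ENat.card (NontrivialIdeal R) ≤ 2 ∧
    (¬ IsField R →
      (∃ (F₁ F₂ : Type u) (_ : Field F₁) (_ : Field F₂), Nonempty (R ≃+* F₁ × F₂)) ∨
      (∃ (F : Type u) (_ : Field F),
        Nonempty (R ≃+* Polynomial F ⧸ Ideal.span {(Polynomial.X : Polynomial F) ^ 2})) ∨
      (∃ (L : Type u) (_ : CommRing L) (p : ℕ), p.Prime ∧ IsCoefficientRing L ∧
        CharP L (p ^ 2) ∧ Nonempty (R ≃+* L))) := by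
  have heq {I J : Ideal R} (hI : I ≠ ⊥) (hJ : J ≠ ⊤) (hIJ : I ≤ J) : I = J :=
    eq_of_le_of_edgeSet_eq_empty hM hG hI hJ hIJ
  have hmax {I : Ideal R} (hI : I ≠ ⊥) (hI' : I ≠ ⊤) : I.IsMaximal := by
    obtain ⟨m, hm, hIm⟩ := I.exists_le_maximal hI'
    rwa [heq hI hm.ne_top hIm]
  have hinf {I J : Ideal R} (hI : I ≠ ⊥) (hI' : I ≠ ⊤) (hJ' : J ≠ ⊤) (hJ : J ≠ ⊥)
      (hIJ : I ≠ J) : I ⊓ J = ⊥ := by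
    by_contra h
    have h1 := heq h hI' inf_le_left
    exact hIJ (heq hI hJ' (inf_eq_left.1 h1))
  constructor
  · by_contra! hcard
    have : Nontrivial (NontrivialIdeal R) :=
      (ENat.one_lt_card_iff_nontrivial _).1 (lt_trans (by norm_num) hcard)
    obtain ⟨I, J, hIJ⟩ := exists_pair_ne (NontrivialIdeal R)
    obtain ⟨K, hIK, hJK⟩ := ENat.exists_ne_ne_of_three_le (Order.add_one_le_of_lt hcard) I J
    -- `IJ ≤ I ⊓ J = 0 ≤ K` with `K` prime forces `I ≤ K` or `J ≤ K`.
    have hle : I.1 * J.1 ≤ K.1 := Ideal.mul_le_inf.trans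
      ((hinf I.2.1 I.2.2 J.2.2 J.2.1 (Subtype.coe_ne_coe.2 hIJ)).le.trans bot_le)
    rcases (hmax K.2.1 K.2.2).isPrime.mul_le.1 hle with h | h
    · exact hIK.symm (Subtype.ext (heq I.2.1 K.2.2 h))
    · exact hJK.symm (Subtype.ext (heq J.2.1 K.2.2 h))
  · intro hR
    obtain ⟨m, hm0, hm1⟩ := Ring.not_isField_iff_exists_ideal_bot_lt_and_lt_top.1 hR
    have hm := hmax hm0.ne' hm1.ne
    by_cases hJ : ∃ J : Ideal R, J ≠ ⊥ ∧ J ≠ ⊤ ∧ m ≠ J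
    · obtain ⟨J, hJ0, hJ1, hne⟩ := hJ
      have hJm := hmax hJ0 hJ1
      refine .inl ⟨R ⧸ m, R ⧸ J, Ideal.Quotient.field m, Ideal.Quotient.field J, ⟨?_⟩⟩
      have hbot := hinf hm0.ne' hm1.ne hJ1 hJ0 hne
      exact (RingEquiv.quotientBot R).symm.trans ((Ideal.quotEquivOfEq hbot.symm).trans
        (Ideal.quotientInfEquivQuotientProd m J
          (Ideal.isCoprime_iff_sup_eq.2 (hm.coprime_of_ne hJm hne))))
    · push Not at hJ
      have : IsLocalRing R := .of_unique_max_ideal ⟨m, hm, fun J hJm => by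
        refine (hJ J ?_ hJm.ne_top).symm
        rintro rfl
        exact hR (Ring.isField_iff_maximal_bot.2 hJm)⟩
      have hmR := IsLocalRing.eq_maximalIdeal hm
      refine .inr ((dualNumber_or_isCoefficientRing (hmR ▸ hm0.ne')
        fun I h0 h1 => hmR ▸ (hJ I h0 h1).symm).imp_right ?_)
      rintro ⟨p, hp, hc, hchar⟩
      exact ⟨R, inferInstance, p, hp, hc, hchar, ⟨RingEquiv.refl R⟩⟩
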